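/- Let \(X\) be a complex manifold of dimension \(n\), \(x\in X\), and \(\mathcal O=\mathcal O_{X,x}\) the ring of germs at \(x\) of holomorphic functions. Let \(\mathcal D\subset \mathrm{End}_{\mathbb C}(\mathcal O)\) be the ring of germs at \(x\) of linear differential operators with holomorphic coefficients, i.e. the subring generated by \(\mathcal O\) (acting by multiplication) and the \(\mathbb C\)-derivations of \(\mathcal O\). For \(f\in\mathcal O\) let \[ \mathrm{Der}(\log f)=\{\delta\in \mathrm{Der}_{\mathbb C}(\mathcal O)\;:\;\delta(f)\in (f)\},\qquad \mathcal V_0^f(\mathcal D)=\{P\in\mathcal D\;:\;P((f)^j)\subset (f)^j\ \text{ for all } j\in\mathbb Z\}, \] where \((f)^j=\mathcal O\) for \(j\le 0\); the elements of \(\mathcal V_0^f(\mathcal D)\) are called logarithmic differential operators. Suppose that \(f\) is free, i.e. that \(\mathrm{Der}(\log f)\) is a free \(\mathcal O\)-module, and let \(\delta_1,\dots,\delta_n\) be a basis of it. Then every logarithmic differential operator \(P\) can be written in a unique way as a finite sum \[ P=\sum_{i_1,\dots,i_n\ge 0}\beta_{i_1\cdots i_n}\,\delta_1^{i_1}\delta_2^{i_2}\cdots\delta_n^{i_n},\qquad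 \beta_{i_1\cdots i_n}\in\mathcal O . \] Moreover, the ring of logarithmic differential operators is the subring of \(\mathcal D\) generated by \(\mathcal O\) and \(\delta_1,\dots,\delta_n\), and also the subring generated by \(\mathcal O\) and all logarithmic derivations: \[ \mathcal V_0^f(\mathcal D)=\mathcal O[\delta_1,\dots,\delta_n]=\mathcal O[\mathrm{Der}(\log f)]. \] -/

import Mathlib

open Filter Topology
open scoped Manifold ContDiff

noncomputable section

namespace LogOp

/-- Germs of complex-valued functions along a filter form a `ℂ`-algebra (for the existing ring and
module structures on germs). -/
instance germAlgebra {X : Type*} (l : Filter X) : Algebra ℂ (Germ l ℂ) :=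
  Algebra.ofModule
    (fun r a b => Quotient.inductionOn₂' a b fun f g =>
      congrArg (fun h : X → ℂ => (h : Germ l ℂ)) (smul_mul_assoc r f g))
    (fun r a b => Quotient.inductionOn₂' a b fun f g =>
      congrArg (fun h : X → ℂ => (h : Germ l ℂ)) (mul_smul_comm r f g))

/-- The local ring `𝒪 = 𝒪_{X,x}` of germs at `x` of holomorphic functions on a complex manifold `X`
of dimension `n`: the germs of the functions that are complex analytic at `x` (equivalently,
holomorphic on a neighbourhood of `x`). -/
def holGerm (n : ℕ) {X : Type*} [TopologicalSpace X] [ChartedSpace (EuclideanSpace ℂ (Fin n)) X]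
    (x : X) : Subalgebra ℂ (Germ (𝓝 x) ℂ) where
  carrier := {g | ∃ φ : X → ℂ,
    ContMDiffAt 𝓘(ℂ, EuclideanSpace ℂ (Fin n)) 𝓘(ℂ, ℂ) ω φ x ∧ (φ : Germ (𝓝 x) ℂ) = g}
  mul_mem' := by
    rintro _ _ ⟨φ, hφ, rfl⟩ ⟨ψ, hψ, rfl⟩
    exact ⟨φ * ψ, hφ.mul hψ, rfl⟩
  add_mem' := by
    rintro _ _ ⟨φ, hφ, rfl⟩ ⟨ψ, hψ, rfl⟩
    exact ⟨φ + ψ, hφ.add hψ, rfl⟩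
  algebraMap_mem' := by
    intro r
    refine ⟨r • (1 : X → ℂ), ?_, ?_⟩
    · exact (contMDiffAt_const (c := r • (1 : ℂ)) :
        ContMDiffAt 𝓘(ℂ, EuclideanSpace ℂ (Fin n)) 𝓘(ℂ, ℂ) ω (fun _ : X => r • (1 : ℂ)) x)
    · rw [Algebra.algebraMap_eq_smul_one]
      rfl

section Algebraic

variable {A : Type*} [CommRing A] [Algebra ℂ A]

/-- The module `Der(log f)` of logarithmic derivations: the `ℂ`-derivations `δ` of `A` with
`δ(f) ∈ (f)`. -/
def derLog (f : A) : Submodule A (Derivation ℂ A A) where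
  carrier := {δ | δ f ∈ Ideal.span {f}}
  add_mem' := by
    intro δ η hδ hη
    simpa using Ideal.add_mem _ hδ hη
  zero_mem' := by simp
  smul_mem' := by
    intro a δ hδ
    simpa using Ideal.mul_mem_left _ a hδ

/-- `f` is free if `Der(log f)` is a free `A`-module. -/
def IsFree (f : A) : Prop := Module.Free A (derLog f)

variable (A) in
/-- The multiplication operators `g ↦ a g`, that is, `A` as a subset of `End_ℂ(A)`. -/
def mulOps : Set (Module.End ℂ A) := Set.range (Algebra.lmul ℂ A)

variable (A) in
/-- The ring `𝒟` of linear differential operators, as the subring of `End_ℂ(A)` generated by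
`A` (multiplication operators) and the `ℂ`-derivations of `A`. (For `A` the local ring of a complex
manifold with local coordinates `z`, these are the finite sums `∑ a_α ∂_z^α`.) -/
def diffOps : Subalgebra ℂ (Module.End ℂ A) :=
  Algebra.adjoin ℂ
    (mulOps A ∪ Set.range fun δ : Derivation ℂ A A => (δ : A →ₗ[ℂ] A))

/-- Powers of an ideal with integer exponent; `I ^ p = A` for `p ≤ 0`. -/
def idealPow (I : Ideal A) (p : ℤ) : Ideal A := I ^ p.toNat

/-- `𝒱_k^I(𝒟) = {P ∈ 𝒟 | P(I^j) ⊆ I^(j-k) for all j ∈ ℤ}`. -/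
def vFiltration (I : Ideal A) (k : ℤ) : Set (Module.End ℂ A) :=
  {P | P ∈ diffOps A ∧ ∀ j : ℤ, ∀ g ∈ idealPow I j, P g ∈ idealPow I (j - k)}

/-- The ring `𝒱_0^f(𝒟)` of logarithmic differential operators: the operators of degree `0` for the
`𝒱`-filtration with respect to the ideal `(f)`. -/
def logOps (f : A) : Subalgebra ℂ (Module.End ℂ A) where
  carrier := vFiltration (Ideal.span {f}) 0
  mul_mem' := by
    rintro P Q ⟨hP, hP'⟩ ⟨hQ, hQ'⟩
    refine ⟨mul_mem hP hQ, fun j g hg => hP' j _ ?_⟩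
    simpa using hQ' j g hg
  add_mem' := by
    rintro P Q ⟨hP, hP'⟩ ⟨hQ, hQ'⟩
    exact ⟨add_mem hP hQ, fun j g hg => Ideal.add_mem _ (hP' j g hg) (hQ' j g hg)⟩
  algebraMap_mem' := by
    intro r
    refine ⟨Subalgebra.algebraMap_mem _ r, fun j g hg => ?_⟩
    rw [Module.algebraMap_end_apply, sub_zero, Algebra.smul_def]
    exact Ideal.mul_mem_left _ _ hg

/-- A logarithmic derivation as a `ℂ`-linear operator on `A`. -/
def toOp {f : A} (δ : derLog f) : Module.End ℂ A := ((δ : Derivation ℂ A A) : A →ₗ[ℂ] A)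

/-- The ordered monomial `δ₁^{i₁} ⋯ δₙ^{iₙ}`, a composition of operators. -/
def monomialOp {f : A} {n : ℕ} (δ : Fin n → derLog f) (i : Fin n → ℕ) : Module.End ℂ A :=
  (List.ofFn fun k => toOp (δ k) ^ i k).prod

/-- The operator `∑ β_i δ₁^{i₁} ⋯ δₙ^{iₙ}` for a finitely supported family `β` of elements of `A`. -/
def polyOp {f : A} {n : ℕ} (δ : Fin n → derLog f) (β : (Fin n → ℕ) →₀ A) : Module.End ℂ A :=
  β.sum fun i b => Algebra.lmul ℂ A b * monomialOp δ i

end Algebraic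

end LogOp

end

/-! Ordered monomials give an `A`-linear map `quant` from polynomials in `X_1, …, X_n` to operators;
it has to be injective with image the logarithmic operators. Order is measured by iterated
commutators with multiplications, and `[quant F, g]` is `quant` of `∑ δ_k(g) ∂F/∂X_k` up to lower
degree (`exists_comm_quant`). Both halves are therefore inductions on degree or order.

Injectivity: if `quant F = 0`, the top component of `F` is killed by every `∑ δ_k(g) ∂/∂X_k`.
Independence of the `δ_k` makes its partial derivatives vanish, and Euler's identity makes it zero.

Surjectivity (`exists_symbol`): for logarithmic `P`, each `[P, g]` is `quant (K g)` by induction.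
The top component `T g` of `K g` is a derivation in `g`. Since `[P, f] = f • Q` with `Q` again
preserving the powers of `(f)`, the coefficients of `T` are logarithmic, so `T g = ∑ δ_k(g) R_k`.
The symmetry of `[[P, g], h]` gives `∂_l R_k = ∂_k R_l`, so the `R_k` are the partial derivatives of
some `F`, and `P - quant F` has smaller order.

Of `𝒪`, this uses only that it is a `ℂ`-algebra without zero divisors. -/

noncomputable section

namespace LogOp

/-! ### Commutators with multiplications, order, and operators preserving the powers of `(f)` -/

section Commutators

variable {A : Type*} [CommRing A] [Algebra ℂ A]

/-- The commutator `[P, g]` of an operator with the multiplication by `g`. -/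
def comm (P : Module.End ℂ A) (g : A) : Module.End ℂ A :=
  P * Algebra.lmul ℂ A g - Algebra.lmul ℂ A g * P

theorem comm_apply (P : Module.End ℂ A) (g h : A) : comm P g h = P (g * h) - g * P h := rfl

theorem comm_add_left (P Q : Module.End ℂ A) (g : A) : comm (P + Q) g = comm P g + comm Q g := by
  ext h; simp [comm_apply]; ring

theorem comm_sub_left (P Q : Module.End ℂ A) (g : A) : comm (P - Q) g = comm P g - comm Q g := by
  ext h; simp [comm_apply]; ring

theorem comm_smul_left (a : A) (P : Module.End ℂ A) (g : A) : comm (a • P) g = a • comm P g := by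
  ext h; simp [comm_apply]; ring

theorem comm_zero_left (g : A) : comm (0 : Module.End ℂ A) g = 0 := by
  ext h; simp [comm_apply]

theorem comm_zero_right (P : Module.End ℂ A) : comm P 0 = 0 := by
  ext h; simp [comm_apply]

theorem comm_add_right (P : Module.End ℂ A) (g h : A) : comm P (g + h) = comm P g + comm P h := by
  ext k; simp [comm_apply, add_mul]; ring

theorem comm_smul_right (P : Module.End ℂ A) (c : ℂ) (g : A) : comm P (c • g) = c • comm P g := by
  ext k; simp [comm_apply, smul_sub]

/-- The last term has lower order than the others, so the leading part of `[P, g]` is a derivation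
in `g`. -/
theorem comm_mul_right (P : Module.End ℂ A) (g h : A) :
    comm P (g * h) = h • comm P g + g • comm P h + comm (comm P g) h := by
  ext k; simp [comm_apply, mul_assoc]; ring

theorem comm_mul_left (P Q : Module.End ℂ A) (g : A) :
    comm (P * Q) g = P * comm Q g + comm P g * Q := by
  ext k; simp [comm_apply]

theorem comm_comm (P : Module.End ℂ A) (g h : A) : comm (comm P g) h = comm (comm P h) g := by
  ext k; simp only [comm_apply, mul_left_comm g h]; ring

theorem comm_lmul (a g : A) : comm (Algebra.lmul ℂ A a) g = 0 := by
  ext k; simp [comm_apply]; ring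

theorem comm_derivation (D : Derivation ℂ A A) (g : A) :
    comm (D : Module.End ℂ A) g = Algebra.lmul ℂ A (D g) := by
  ext k; simp [comm_apply]; ring

theorem eq_lmul_of_comm_eq_zero {P : Module.End ℂ A} (hP : ∀ g, comm P g = 0) :
    P = Algebra.lmul ℂ A (P 1) := by
  ext g
  have := LinearMap.congr_fun (hP g) 1
  simp only [comm_apply, mul_one, LinearMap.zero_apply] at this
  simpa [mul_comm] using sub_eq_zero.1 this

variable (A) in
/-- Operators of order less than `d`, defined by iterated commutators with multiplications. -/
def ordLT : ℕ → Submodule A (Module.End ℂ A)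
  | 0 => ⊥
  | d + 1 =>
    { carrier := {P | ∀ g, comm P g ∈ ordLT d}
      add_mem' := fun hP hQ g => by rw [comm_add_left]; exact add_mem (hP g) (hQ g)
      zero_mem' := fun g => by rw [comm_zero_left]; exact zero_mem _
      smul_mem' := fun a P hP g => by rw [comm_smul_left]; exact Submodule.smul_mem _ a (hP g) }

theorem mem_ordLT_zero {P : Module.End ℂ A} : P ∈ ordLT A 0 ↔ P = 0 := Submodule.mem_bot A

theorem ordLT_le_succ (d : ℕ) : ordLT A d ≤ ordLT A (d + 1) := by
  induction d with
  | zero => exact bot_le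
  | succ d ih => exact fun P hP g => ih (hP g)

theorem ordLT_mono : Monotone (ordLT A) := monotone_nat_of_le_succ ordLT_le_succ

/-- A commutator with the product lowers the order of one factor, hence induction on `d + e`. The
bound is not sharp, but only finiteness of the order is needed. -/
theorem mul_mem_ordLT (s : ℕ) : ∀ d e : ℕ, d + e = s → ∀ P ∈ ordLT A d, ∀ Q ∈ ordLT A e,
    P * Q ∈ ordLT A (d + e) := by
  induction s with
  | zero =>
    intro d e h P hP Q hQ
    obtain rfl : d = 0 := by omega
    rw [mem_ordLT_zero] at hP
    rw [hP, zero_mul]; exact zero_mem _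
  | succ s ih =>
    intro d e h P hP Q hQ
    match d, e with
    | 0, e => rw [mem_ordLT_zero] at hP; rw [hP, zero_mul]; exact zero_mem _
    | d + 1, 0 => rw [mem_ordLT_zero] at hQ; rw [hQ, mul_zero]; exact zero_mem _
    | d + 1, e + 1 =>
      intro g
      rw [comm_mul_left]
      refine add_mem (ih (d + 1) e (by omega) P hP _ (hQ g)) ?_
      have := ih d (e + 1) (by omega) _ (hP g) Q hQ
      rw [show d + (e + 1) = d + 1 + e by omega] at this
      exact this

theorem lmul_mem_ordLT (a : A) : Algebra.lmul ℂ A a ∈ ordLT A 1 := fun g => by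
  rw [comm_lmul]; exact zero_mem _

theorem exists_mem_ordLT_of_mem_diffOps {P : Module.End ℂ A} (hP : P ∈ diffOps A) :
    ∃ d, P ∈ ordLT A d := by
  induction hP using Algebra.adjoin_induction with
  | mem P hP =>
    rcases hP with ⟨a, rfl⟩ | ⟨D, rfl⟩
    · exact ⟨1, lmul_mem_ordLT a⟩
    · exact ⟨2, fun g => by rw [comm_derivation]; exact lmul_mem_ordLT _⟩
  | algebraMap r =>
    refine ⟨1, ?_⟩
    rw [← AlgHom.commutes (Algebra.lmul ℂ A)]
    exact lmul_mem_ordLT _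
  | add P Q _ _ hP hQ =>
    obtain ⟨d, hd⟩ := hP
    obtain ⟨e, he⟩ := hQ
    exact ⟨max d e, add_mem (ordLT_mono (le_max_left d e) hd) (ordLT_mono (le_max_right d e) he)⟩
  | mul P Q _ _ hP hQ =>
    obtain ⟨d, hd⟩ := hP
    obtain ⟨e, he⟩ := hQ
    exact ⟨d + e, mul_mem_ordLT _ d e rfl P hd Q he⟩

/-- Commutators are `A`-linear in the operator, so `f` is carried down to order zero and cancelled
there. -/
theorem mem_ordLT_of_smul_mem [NoZeroDivisors A] {f : A} (hf : f ≠ 0) {d : ℕ} :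
    ∀ {P : Module.End ℂ A}, f • P ∈ ordLT A d → P ∈ ordLT A d := by
  induction d with
  | zero =>
    intro P hP
    rw [mem_ordLT_zero] at hP ⊢
    ext g
    have := LinearMap.congr_fun hP g
    simpa [hf] using this
  | succ d ih =>
    intro P hP g
    apply ih
    rw [← comm_smul_left]
    exact hP g

/-- The operators that map every power of the ideal `(f)` to itself. -/
def stableOps (f : A) : Subalgebra ℂ (Module.End ℂ A) where
  carrier := {P | ∀ (j : ℕ) (g : A), f ^ j ∣ g → f ^ j ∣ P g}
  mul_mem' := fun hP hQ j g hg => hP j _ (hQ j g hg)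
  add_mem' := fun hP hQ j g hg => dvd_add (hP j g hg) (hQ j g hg)
  algebraMap_mem' := fun r j g hg => by
    rw [Module.algebraMap_end_apply, Algebra.smul_def]
    exact hg.mul_left _

theorem mem_logOps {f : A} {P : Module.End ℂ A} :
    P ∈ logOps f ↔ P ∈ diffOps A ∧ P ∈ stableOps f := by
  refine and_congr_right fun _ => ⟨fun h j g hg => ?_, fun h j g hg => ?_⟩
  · have := h j g
    simp only [idealPow, sub_zero, Int.toNat_natCast, Ideal.span_singleton_pow,
      Ideal.mem_span_singleton] at this
    exact this hg
  · simp only [idealPow, sub_zero, Ideal.span_singleton_pow, Ideal.mem_span_singleton] at hg ⊢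
    exact h _ g hg

theorem lmul_mem_stableOps (f a : A) : Algebra.lmul ℂ A a ∈ stableOps f :=
  fun _ _ hg => hg.mul_left a

theorem toOp_mem_stableOps {f : A} (η : derLog f) : toOp η ∈ stableOps f := by
  rintro j g ⟨h, rfl⟩
  obtain ⟨b, hb⟩ := Ideal.mem_span_singleton.1 η.2
  show f ^ j ∣ (η : Derivation ℂ A A) (f ^ j * h)
  rw [Derivation.leibniz, Derivation.leibniz_pow, hb]
  cases j with
  | zero => simp
  | succ j =>
    refine dvd_add (Dvd.intro _ rfl) ⟨h * ((j + 1 : ℕ) * b), ?_⟩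
    simp only [smul_eq_mul, nsmul_eq_mul, Nat.add_sub_cancel]
    ring

theorem comm_mem_stableOps {f : A} {P : Module.End ℂ A} (hP : P ∈ stableOps f) (g : A) :
    comm P g ∈ stableOps f :=
  sub_mem (mul_mem hP (lmul_mem_stableOps f g)) (mul_mem (lmul_mem_stableOps f g) hP)

/-- The commutator of a stable operator with `f` is divisible by `f` among stable operators. -/
theorem exists_smul_eq_comm [NoZeroDivisors A] {f : A} {P : Module.End ℂ A}
    (hP : P ∈ stableOps f) {d : ℕ} (hd : P ∈ ordLT A (d + 1)) :
    ∃ Q ∈ stableOps f, Q ∈ ordLT A d ∧ comm P f = f • Q := by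
  by_cases hf : f = 0
  · exact ⟨0, zero_mem _, zero_mem _, by rw [hf, comm_zero_right, smul_zero]⟩
  have key : ∀ g, ∃ b, comm P f g = f * b := fun g => by
    have h := hP 1 (f * g) (by simp)
    rw [pow_one] at h
    exact dvd_sub h (Dvd.intro _ rfl)
  choose Q hQ using key
  let Q' : Module.End ℂ A :=
    { toFun := Q
      map_add' := fun a b => mul_left_cancel₀ hf (by rw [mul_add, ← hQ, ← hQ, ← hQ, map_add])
      map_smul' := fun c a => mul_left_cancel₀ hf (by
        rw [RingHom.id_apply, mul_smul_comm, ← hQ, ← hQ, map_smul]) }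
  have hQ' : comm P f = f • Q' := LinearMap.ext hQ
  refine ⟨Q', ?_, mem_ordLT_of_smul_mem hf (hQ' ▸ hd f), hQ'⟩
  intro j g hg
  -- For `g ∈ (f^j)`, both terms of `f * Q g = P (f * g) - f * P g` lie in `(f^(j+1))`; one factor
  -- `f` cancels.
  refine (mul_dvd_mul_iff_left hf).1 ?_
  show f * f ^ j ∣ f * Q g
  rw [← hQ, comm_apply, ← pow_succ']
  refine dvd_sub (hP (j + 1) _ ?_) ?_
  · rw [pow_succ']; exact mul_dvd_mul_left f hg
  · rw [pow_succ']; exact mul_dvd_mul_left f (hP j g hg)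

end Commutators

/-! ### Polynomials, sorted lists of indices and degree bounds -/

section OrderedMonomials

open MvPolynomial

variable {A : Type*} [CommRing A] {n : ℕ}

variable (A) in
/-- The commutative monomial of a list of indices. -/
def monList (l : List (Fin n)) : MvPolynomial (Fin n) A :=
  (l.map X).prod

theorem monList_cons (k : Fin n) (l : List (Fin n)) : monList A (k :: l) = X k * monList A l := by
  simp [monList]

/-- The sorted list in which `k` occurs `i k` times. -/
def sortedList (i : Fin n → ℕ) : List (Fin n) :=
  (List.ofFn fun k => List.replicate (i k) k).flatten

theorem pairwise_sortedList (i : Fin n → ℕ) : (sortedList i).Pairwise (· ≤ ·) := by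
  rw [sortedList, List.pairwise_flatten]
  refine ⟨fun l hl => ?_, ?_⟩
  · obtain ⟨k, rfl⟩ := (List.mem_ofFn' _ _).1 hl
    exact List.pairwise_replicate.2 (Or.inr le_rfl)
  · rw [List.pairwise_ofFn]
    intro k k' hk a ha b hb
    rw [List.eq_of_mem_replicate ha, List.eq_of_mem_replicate hb]
    exact hk.le

theorem monList_sortedList (i : Fin n →₀ ℕ) :
    monList A (sortedList i) = monomial i 1 := by
  rw [monomial_eq, map_one, one_mul, Finsupp.prod_fintype _ _ (fun _ => pow_zero _)]
  simp [monList, sortedList, List.map_flatten, List.prod_flatten, List.map_ofFn,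
    Function.comp_def, List.prod_ofFn]

theorem length_sortedList (i : Fin n →₀ ℕ) : (sortedList i).length = i.degree := by
  simp [sortedList, List.length_flatten, List.map_ofFn, Function.comp_def, List.sum_ofFn,
    Finsupp.degree_eq_sum]

theorem count_sortedList (i : Fin n → ℕ) (k : Fin n) : (sortedList i).count k = i k := by
  simp [sortedList, List.count_flatten, List.map_ofFn, Function.comp_def, List.sum_ofFn,
    List.count_replicate]

theorem exists_eq_sortedList {l : List (Fin n)} (hl : l.Pairwise (· ≤ ·)) :
    ∃ i : Fin n →₀ ℕ, l = sortedList i := by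
  refine ⟨Finsupp.equivFunOnFinite.symm fun k => l.count k, ?_⟩
  refine List.Perm.eq_of_pairwise (fun a b _ _ h h' => le_antisymm h h') hl
    (pairwise_sortedList _) ?_
  rw [List.perm_iff_count]
  intro k
  rw [count_sortedList]
  rfl

variable (A n) in
/-- Polynomials of degree less than `d`. -/
def degLT (d : ℕ) : Submodule A (MvPolynomial (Fin n) A) where
  carrier := {F | ∀ i : Fin n →₀ ℕ, d ≤ i.degree → coeff i F = 0}
  add_mem' := fun hF hG i hi => by rw [coeff_add, hF i hi, hG i hi, add_zero]
  zero_mem' := fun i _ => coeff_zero i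
  smul_mem' := fun a F hF i hi => by rw [coeff_smul, hF i hi, smul_zero]

theorem degLT_mono {d e : ℕ} (h : d ≤ e) : degLT A n d ≤ degLT A n e :=
  fun _ hF i hi => hF i (h.trans hi)

theorem eq_zero_of_mem_degLT_zero {F : MvPolynomial (Fin n) A} (hF : F ∈ degLT A n 0) : F = 0 :=
  MvPolynomial.ext _ _ fun i => hF i (Nat.zero_le _)

theorem _root_.MvPolynomial.IsHomogeneous.mem_degLT {F : MvPolynomial (Fin n) A} {e d : ℕ}
    (hF : F.IsHomogeneous e) (h : e < d) : F ∈ degLT A n d := fun i hi =>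
  hF.coeff_eq_zero (by omega)

theorem exists_mem_degLT (F : MvPolynomial (Fin n) A) : ∃ d, F ∈ degLT A n d :=
  ⟨F.totalDegree + 1, fun i hi => coeff_eq_zero_of_totalDegree_lt (by
    rw [Finsupp.degree_apply] at hi; exact hi)⟩

theorem sub_homogeneousComponent_mem_degLT {e : ℕ} {F : MvPolynomial (Fin n) A}
    (hF : F ∈ degLT A n (e + 1)) : F - homogeneousComponent e F ∈ degLT A n e := by
  intro i hi
  rw [coeff_sub, coeff_homogeneousComponent]
  split_ifs with h
  · exact sub_self _
  · rw [hF i (by omega), sub_zero]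

theorem homogeneousComponent_of_mem_degLT {e : ℕ} {F : MvPolynomial (Fin n) A}
    (hF : F ∈ degLT A n e) : homogeneousComponent e F = 0 := by
  ext i
  rw [coeff_homogeneousComponent, coeff_zero]
  split_ifs with h
  · exact hF i h.ge
  · rfl

theorem homogeneousComponent_eq_of_isHomogeneous {e : ℕ} {F : MvPolynomial (Fin n) A}
    (hF : F.IsHomogeneous e) : homogeneousComponent e F = F := by
  rw [homogeneousComponent_of_mem hF, if_pos rfl]

theorem monList_mem_degLT {l : List (Fin n)} {d : ℕ} (h : l.length < d) :
    monList A l ∈ degLT A n d := by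
  refine IsHomogeneous.mem_degLT (e := l.length) ?_ h
  induction l generalizing d with
  | nil => exact isHomogeneous_one _ _
  | cons k l ih =>
    rw [monList_cons, List.length_cons, add_comm]
    exact (isHomogeneous_X _ _).mul (ih (Nat.lt_succ_self _))

/-- Lower-order terms are tracked by sublists of `l`, with `c` counting lost letters, because
sublists of a sorted list stay sorted; a degree bound would forget this. -/
theorem image_monList_cons_mem {k : Fin n} {l : List (Fin n)} {c : ℕ} {H : MvPolynomial (Fin n) A}
    (hH : H ∈ Submodule.span A (monList A '' {v | v.Sublist l ∧ v.length + c ≤ l.length})) :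
    X k * H ∈ Submodule.span A
      (monList A '' {v | v.Sublist (k :: l) ∧ v.length + c ≤ (k :: l).length}) := by
  induction hH using Submodule.span_induction with
  | mem H hH =>
    obtain ⟨v, ⟨hv, hv'⟩, rfl⟩ := hH
    rw [← monList_cons]
    refine Submodule.subset_span ⟨_, ⟨hv.cons_cons k, ?_⟩, rfl⟩
    simp only [List.length_cons]
    omega
  | zero => rw [mul_zero]; exact zero_mem _
  | add H K _ _ hH hK => rw [mul_add]; exact add_mem hH hK
  | smul a H _ hH => rw [mul_smul_comm]; exact Submodule.smul_mem _ _ hH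

theorem span_monList_sublist_le (k : Fin n) (l : List (Fin n)) {c c' : ℕ} (h : c' ≤ c + 1) :
    Submodule.span A (monList A '' {v | v.Sublist l ∧ v.length + c ≤ l.length}) ≤
    Submodule.span A (monList A '' {v | v.Sublist (k :: l) ∧ v.length + c' ≤ (k :: l).length}) := by
  refine Submodule.span_mono (Set.image_mono ?_)
  rintro v ⟨hv, hv'⟩
  refine ⟨hv.cons k, ?_⟩
  simp only [List.length_cons]
  omega

end OrderedMonomials

/-! ### The map `quant` and its commutators with multiplications -/

section Quantization

open MvPolynomial

variable {A : Type*} [CommRing A] [Algebra ℂ A] {f : A} {n : ℕ}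

/-- The `A`-linear map sending the monomial `X^i` to the ordered monomial operator `δ^i`. -/
def quant (δ : Fin n → derLog f) : MvPolynomial (Fin n) A →ₗ[A] Module.End ℂ A :=
  (basisMonomials (Fin n) A).constr A fun i => monomialOp δ i

theorem quant_monomial (δ : Fin n → derLog f) (i : Fin n →₀ ℕ) (a : A) :
    quant δ (monomial i a) = a • monomialOp δ i := by
  have h : (monomial i a : MvPolynomial (Fin n) A) = a • basisMonomials (Fin n) A i := by
    simp [smul_monomial]
  rw [h, map_smul, quant, Module.Basis.constr_basis]

/-- The composition of the operators `δ_k`, for `k` in a list. -/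
def opList (δ : Fin n → derLog f) (l : List (Fin n)) : Module.End ℂ A :=
  (l.map fun k => toOp (δ k)).prod

theorem opList_cons (δ : Fin n → derLog f) (k : Fin n) (l : List (Fin n)) :
    opList δ (k :: l) = toOp (δ k) * opList δ l := by
  simp [opList]

theorem opList_sortedList (δ : Fin n → derLog f) (i : Fin n → ℕ) :
    opList δ (sortedList i) = monomialOp δ i := by
  simp [opList, sortedList, monomialOp, List.map_flatten, List.prod_flatten, List.map_ofFn,
    Function.comp_def]

theorem quant_monList (δ : Fin n → derLog f) {l : List (Fin n)} (hl : l.Pairwise (· ≤ ·)) :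
    quant δ (monList A l) = opList δ l := by
  obtain ⟨i, rfl⟩ := exists_eq_sortedList hl
  rw [monList_sortedList, opList_sortedList, quant_monomial, one_smul]

theorem quant_C (δ : Fin n → derLog f) (a : A) : quant δ (C a) = Algebra.lmul ℂ A a := by
  have h : (C a : MvPolynomial (Fin n) A) = a • monList A [] := by
    simp [monList, smul_eq_C_mul]
  rw [h, map_smul, quant_monList δ List.Pairwise.nil]
  ext; simp [opList]

/-- The derivation `∑ δ_k(g) ∂/∂X_k` of the polynomial ring: the symbol of `[·, g]`. -/
def symbolDer (δ : Fin n → derLog f) (g : A) :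
    Derivation A (MvPolynomial (Fin n) A) (MvPolynomial (Fin n) A) :=
  mkDerivation A fun k => C ((δ k : Derivation ℂ A A) g)

theorem symbolDer_apply (δ : Fin n → derLog f) (g : A) (F : MvPolynomial (Fin n) A) :
    symbolDer δ g F = ∑ k, (δ k : Derivation ℂ A A) g • pderiv k F := by
  have h : symbolDer δ g = ∑ k, (δ k : Derivation ℂ A A) g • pderiv k := by
    refine MvPolynomial.derivation_ext fun j => ?_
    rw [← Derivation.coeFnAddMonoidHom_apply (∑ k, _), map_sum, Finset.sum_apply]
    simp [symbolDer, pderiv_X, Pi.single_apply, smul_eq_C_mul]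
  rw [h, ← Derivation.coeFnAddMonoidHom_apply (∑ k, _), map_sum, Finset.sum_apply]
  rfl

theorem symbolDer_X_mul (δ : Fin n → derLog f) (g : A) (k : Fin n) (F : MvPolynomial (Fin n) A) :
    symbolDer δ g (X k * F) = X k * symbolDer δ g F + (δ k : Derivation ℂ A A) g • F := by
  rw [Derivation.leibniz, symbolDer, mkDerivation_X, smul_eq_mul, smul_eq_mul, smul_eq_C_mul,
    mul_comm F]

theorem _root_.MvPolynomial.IsHomogeneous.symbolDer {F : MvPolynomial (Fin n) A} {e : ℕ}
    (hF : F.IsHomogeneous (e + 1)) (δ : Fin n → derLog f) (g : A) :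
    (symbolDer δ g F).IsHomogeneous e := by
  rw [symbolDer_apply]
  refine IsHomogeneous.sum _ _ _ fun k _ => ?_
  rw [smul_eq_C_mul]
  exact hF.pderiv.C_mul _

theorem symbolDer_mem_degLT (δ : Fin n → derLog f) (g : A) {d : ℕ} {F : MvPolynomial (Fin n) A}
    (hF : F ∈ degLT A n (d + 1)) : symbolDer δ g F ∈ degLT A n d := by
  rw [symbolDer_apply]
  refine sum_mem fun k _ => Submodule.smul_mem _ _ fun i hi => ?_
  rw [coeff_pderiv, hF _ (by simpa using hi), zero_mul]

/-- Composition with `δ_k` on the left, on ordered monomials that may follow `δ_k`. -/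
theorem exists_toOp_mul_quant (δ : Fin n → derLog f) (k : Fin n) {S : Set (List (Fin n))}
    (hS : ∀ v ∈ S, (k :: v).Pairwise (· ≤ ·)) {H : MvPolynomial (Fin n) A}
    (hH : H ∈ Submodule.span A (monList A '' S)) :
    ∃ H' ∈ Submodule.span A (monList A '' S), toOp (δ k) * quant δ H = quant δ (X k * H + H') := by
  induction hH using Submodule.span_induction with
  | mem H hH =>
    obtain ⟨v, hv, rfl⟩ := hH
    refine ⟨0, zero_mem _, ?_⟩
    rw [add_zero, ← monList_cons, quant_monList δ (hS v hv),
      quant_monList δ (List.pairwise_cons.1 (hS v hv)).2, opList_cons]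
  | zero => exact ⟨0, zero_mem _, by simp⟩
  | add H K _ _ hH hK =>
    obtain ⟨H', hH', h⟩ := hH
    obtain ⟨K', hK', h'⟩ := hK
    refine ⟨H' + K', add_mem hH' hK', ?_⟩
    rw [map_add, mul_add, h, h', ← map_add]
    ring_nf
  | smul a H hH ih =>
    obtain ⟨H', hH', h⟩ := ih
    -- The only error comes from `δ_k` differentiating the coefficient `a`, and it leaves the
    -- monomial unchanged.
    refine ⟨a • H' + (δ k : Derivation ℂ A A) a • H,
      add_mem (Submodule.smul_mem _ _ hH') (Submodule.smul_mem _ _ hH), ?_⟩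
    have h1 : toOp (δ k) * quant δ (a • H) =
        a • (toOp (δ k) * quant δ H) + (δ k : Derivation ℂ A A) a • quant δ H := by
      ext g
      simp only [map_smul]
      show (δ k : Derivation ℂ A A) (a * quant δ H g) =
        a * (δ k : Derivation ℂ A A) (quant δ H g) + (δ k : Derivation ℂ A A) a * quant δ H g
      rw [Derivation.leibniz, smul_eq_mul, smul_eq_mul, mul_comm (quant δ H g)]
    rw [h1, h, ← map_smul, ← map_smul, ← map_add, smul_add, mul_smul_comm, add_assoc]

/-- Induction by `[δ_k L, g] = δ_k [L, g] + δ_k(g) L`. Only deletions of letters occur, so every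
term remains an ordered monomial and no bracket `[δ_j, δ_k]` has to be rewritten. -/
theorem exists_comm_opList (δ : Fin n → derLog f) (g : A) {l : List (Fin n)}
    (hl : l.Pairwise (· ≤ ·)) :
    symbolDer δ g (monList A l) ∈
      Submodule.span A (monList A '' {v | v.Sublist l ∧ v.length + 1 ≤ l.length}) ∧
    ∃ H ∈ Submodule.span A (monList A '' {v | v.Sublist l ∧ v.length + 2 ≤ l.length}),
      comm (opList δ l) g = quant δ (symbolDer δ g (monList A l) + H) := by
  induction l with
  | nil =>
    have h0 : symbolDer δ g (monList A []) = 0 := by simp [monList]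
    refine ⟨by rw [h0]; exact zero_mem _, 0, zero_mem _, ?_⟩
    rw [h0, add_zero, map_zero]
    ext; simp [comm_apply, opList]
  | cons k l ih =>
    have hl' := (List.pairwise_cons.1 hl).2
    obtain ⟨h1, H, hH, h2⟩ := ih hl'
    have hsort : ∀ c, ∀ v ∈ {v : List (Fin n) | v.Sublist l ∧ v.length + c ≤ l.length},
        (k :: v).Pairwise (· ≤ ·) := fun c v hv => hl.sublist (hv.1.cons_cons k)
    obtain ⟨K₁, hK₁, e₁⟩ := exists_toOp_mul_quant δ k (hsort 1) h1
    obtain ⟨K₂, hK₂, e₂⟩ := exists_toOp_mul_quant δ k (hsort 2) hH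
    rw [monList_cons, symbolDer_X_mul]
    refine ⟨add_mem (image_monList_cons_mem h1) (Submodule.smul_mem _ _ (Submodule.subset_span
      ⟨l, ⟨List.sublist_cons_self k l, by simp⟩, rfl⟩)), K₁ + (X k * H + K₂), ?_, ?_⟩
    · exact add_mem (span_monList_sublist_le k l le_rfl hK₁)
        (add_mem (image_monList_cons_mem hH) (span_monList_sublist_le k l (by omega) hK₂))
    · have h3 : comm (toOp (δ k)) g * opList δ l =
          (δ k : Derivation ℂ A A) g • opList δ l := by
        rw [toOp, comm_derivation]
        rfl
      rw [opList_cons, comm_mul_left, h2, h3, map_add, mul_add, e₁, e₂, ← quant_monList δ hl',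
        ← map_smul, ← map_add, ← map_add]
      congr 1
      abel

/-- The commutator of `quant F` with `g` is `quant` of the symbol, up to terms of lower order. -/
theorem exists_comm_quant (δ : Fin n → derLog f) (g : A) {d : ℕ} {F : MvPolynomial (Fin n) A}
    (hF : F ∈ degLT A n (d + 1)) :
    ∃ G ∈ degLT A n (d - 1), comm (quant δ F) g = quant δ (symbolDer δ g F + G) := by
  let N : Submodule A (MvPolynomial (Fin n) A) :=
    { carrier := {F | ∃ G ∈ degLT A n (d - 1),
        comm (quant δ F) g = quant δ (symbolDer δ g F + G)}
      add_mem' := by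
        rintro F F' ⟨G, hG, h⟩ ⟨G', hG', h'⟩
        refine ⟨G + G', add_mem hG hG', ?_⟩
        rw [map_add, comm_add_left, h, h', ← map_add, map_add (symbolDer δ g), add_add_add_comm]
      zero_mem' := ⟨0, zero_mem _, by simp [comm_zero_left]⟩
      smul_mem' := by
        rintro a F ⟨G, hG, h⟩
        refine ⟨a • G, Submodule.smul_mem _ _ hG, ?_⟩
        rw [map_smul, comm_smul_left, h, ← map_smul, Derivation.map_smul, smul_add] }
  show F ∈ N
  rw [F.as_sum]
  refine sum_mem fun i hi => ?_
  have hd : i.degree ≤ d := by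
    by_contra! h
    exact mem_support_iff.1 hi (hF i h)
  rw [← mul_one (coeff i F), ← smul_eq_mul, ← smul_monomial]
  refine Submodule.smul_mem _ _ ?_
  obtain ⟨-, H, hH, h⟩ := exists_comm_opList (A := A) δ g (pairwise_sortedList i)
  refine ⟨H, ?_, ?_⟩
  · refine Submodule.span_le.2 ?_ hH
    rintro _ ⟨v, ⟨-, hv⟩, rfl⟩
    rw [length_sortedList] at hv
    -- For `d ≤ 1` no list `v` is short enough, so the truncated `d - 1` is harmless.
    exact monList_mem_degLT (by omega)
  · rw [← monList_sortedList, quant_monList δ (pairwise_sortedList i), h]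

theorem quant_mem_ordLT (δ : Fin n → derLog f) {d : ℕ} :
    ∀ {F : MvPolynomial (Fin n) A}, F ∈ degLT A n d → quant δ F ∈ ordLT A d := by
  induction d with
  | zero =>
    intro F hF
    rw [eq_zero_of_mem_degLT_zero hF, map_zero]
    exact zero_mem _
  | succ d ih =>
    intro F hF g
    obtain ⟨G, hG, h⟩ := exists_comm_quant δ g hF
    rw [h]
    exact ih (add_mem (symbolDer_mem_degLT δ g hF) (degLT_mono (Nat.sub_le d 1) hG))

end Quantization

/-! ### The ring of holomorphic germs has no zero divisors -/

section Domain

/-- Analytic functions whose product vanishes near a point: one factor vanishes near the point. -/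
theorem _root_.AnalyticAt.eventuallyEq_zero_or_of_mul {E : Type*} [NormedAddCommGroup E]
    [NormedSpace ℂ E] {u v : E → ℂ} {z : E} (hu : AnalyticAt ℂ u z)
    (hv : AnalyticAt ℂ v z) (h : ∀ᶠ y in 𝓝 z, u y * v y = 0) : u =ᶠ[𝓝 z] 0 ∨ v =ᶠ[𝓝 z] 0 := by
  by_contra! hcon
  obtain ⟨r, hr, hball⟩ := Metric.eventually_nhds_iff_ball.1
    (h.and (hu.eventually_analyticAt.and hv.eventually_analyticAt))
  have hmem : Metric.ball z r ∈ 𝓝 z := Metric.ball_mem_nhds z hr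
  have hfreq : ∃ᶠ y in 𝓝 z, v y ≠ 0 := Filter.not_eventually.1 hcon.2
  obtain ⟨y, hy, hvy⟩ := (hfreq.and_eventually hmem).exists.imp fun _ h => h.symm
  -- Near a point `y` of the ball with `v y ≠ 0` the factor `u` vanishes, hence on the whole ball by
  -- the identity theorem.
  have hu0 : u =ᶠ[𝓝 y] 0 := by
    filter_upwards [(hball y hy).2.2.continuousAt.eventually_ne hvy,
      Metric.isOpen_ball.mem_nhds hy] with w hw hwb
    exact (mul_eq_zero.1 (hball w hwb).1).resolve_right hw
  have := AnalyticOnNhd.eqOn_zero_of_preconnected_of_eventuallyEq_zero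
    (fun w hw => (hball w hw).2.1) (convex_ball z r).isPreconnected hy hu0
  exact hcon.1 (this.eventuallyEq_of_mem hmem)

variable {n : ℕ} {X : Type*} [TopologicalSpace X] [ChartedSpace (EuclideanSpace ℂ (Fin n)) X]

theorem analyticAt_comp_chart_symm {x : X} {φ : X → ℂ}
    (hφ : ContMDiffAt 𝓘(ℂ, EuclideanSpace ℂ (Fin n)) 𝓘(ℂ, ℂ) ω φ x) :
    AnalyticAt ℂ (φ ∘ (chartAt (EuclideanSpace ℂ (Fin n)) x).symm)
      (chartAt (EuclideanSpace ℂ (Fin n)) x x) := by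
  have h := (contMDiffAt_iff.1 hφ).2
  simp only [extChartAt, mfld_simps, contDiffWithinAt_univ] at h
  exact h.analyticAt

instance noZeroDivisors_holGerm (x : X) : NoZeroDivisors (holGerm n x) where
  eq_zero_or_eq_zero_of_mul_eq_zero := by
    rintro ⟨_, φ, hφ, rfl⟩ ⟨_, ψ, hψ, rfl⟩ h
    set e := chartAt (EuclideanSpace ℂ (Fin n)) x with he
    have hx : x ∈ e.source := mem_chart_source _ x
    have h0 : (fun y => φ y * ψ y) =ᶠ[𝓝 x] 0 := Germ.coe_eq.1 (congrArg Subtype.val h)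
    have back : ∀ χ : X → ℂ, χ ∘ e.symm =ᶠ[𝓝 (e x)] 0 → χ =ᶠ[𝓝 x] 0 := fun χ hχ => by
      filter_upwards [(e.continuousAt hx).eventually hχ, e.open_source.mem_nhds hx] with y hy hys
      simpa [e.left_inv hys] using hy
    have h1 : ∀ᶠ y in 𝓝 (e x), φ (e.symm y) * ψ (e.symm y) = 0 := by
      have := e.continuousAt_symm (e.map_source hx)
      rw [ContinuousAt, e.left_inv hx] at this
      exact this.eventually h0
    rcases (analyticAt_comp_chart_symm hφ).eventuallyEq_zero_or_of_mul
      (analyticAt_comp_chart_symm hψ) h1 with h2 | h2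
    · exact Or.inl (Subtype.ext (Germ.coe_eq.2 (back _ h2)))
    · exact Or.inr (Subtype.ext (Germ.coe_eq.2 (back _ h2)))

end Domain

/-! ### Injectivity of `quant`, and its surjectivity by integrating symbols -/

section FreeDivisor

open MvPolynomial

variable {A : Type*} [CommRing A] [Algebra ℂ A] {f : A} {n : ℕ}

theorem sum_smul_derLog_apply (δ : Fin n → derLog f) (c : Fin n → A) (g : A) :
    ((∑ k, c k • δ k : derLog f) : Derivation ℂ A A) g =
      ∑ k, c k * (δ k : Derivation ℂ A A) g := by
  let ev : derLog f →+ A :=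
    (Pi.evalAddMonoidHom (fun _ : A => A) g).comp
      (Derivation.coeFnAddMonoidHom.comp (derLog f).subtype.toAddMonoidHom)
  exact map_sum ev _ _

/-- Each coefficient of the relation, read for all `g`, is a linear relation between the derivations
`δ_k`. -/
theorem eq_zero_of_sum_smul_eq_zero {δ : Fin n → derLog f} (hδ : LinearIndependent A δ)
    {R : Fin n → MvPolynomial (Fin n) A}
    (h : ∀ g, ∑ k, (δ k : Derivation ℂ A A) g • R k = 0) (k : Fin n) : R k = 0 := by
  ext i
  refine Fintype.linearIndependent_iff.1 hδ (fun k => coeff i (R k)) ?_ k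
  refine Subtype.ext (Derivation.ext fun g => ?_)
  rw [sum_smul_derLog_apply]
  have := congrArg (coeff i) (h g)
  rw [coeff_sum, coeff_zero] at this
  simpa [mul_comm] using this

theorem _root_.MvPolynomial.IsHomogeneous.eq_zero_of_pderiv_eq_zero {F : MvPolynomial (Fin n) A}
    {e : ℕ} (hF : F.IsHomogeneous (e + 1)) (h : ∀ k, pderiv k F = 0) : F = 0 := by
  have h1 := hF.sum_X_mul_pderiv
  simp only [h, mul_zero, Finset.sum_const_zero] at h1
  have h2 : ((e + 1 : ℕ) : ℂ) • F = 0 := by rw [Nat.cast_smul_eq_nsmul, ← h1]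
  rw [← inv_smul_smul₀ (Nat.cast_ne_zero.2 e.succ_ne_zero : ((e + 1 : ℕ) : ℂ) ≠ 0) F, h2, smul_zero]

theorem eq_zero_of_quant_eq_zero {δ : Fin n → derLog f} (hδ : LinearIndependent A δ) (d : ℕ) :
    ∀ F ∈ degLT A n d, quant δ F = 0 → F = 0 := by
  induction d using Nat.strong_induction_on with
  | _ d ih =>
  intro F hF h0
  match d with
  | 0 => exact eq_zero_of_mem_degLT_zero hF
  | 1 =>
    have h1 : F = C (coeff 0 F) := by
      ext i
      rw [coeff_C]
      split_ifs with h
      · rw [h]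
      · exact hF i (Nat.one_le_iff_ne_zero.2 fun h' => h ((Finsupp.degree_eq_zero_iff i).1 h').symm)
    rw [h1, quant_C] at h0
    have := LinearMap.congr_fun h0 1
    simp only [Algebra.coe_lmul_eq_mul, LinearMap.mul_apply', mul_one, LinearMap.zero_apply] at this
    rw [h1, this, map_zero]
  | e + 2 =>
    suffices h : homogeneousComponent (e + 1) F = 0 by
      refine ih (e + 1) (by omega) F ?_ h0
      simpa [h] using sub_homogeneousComponent_mem_degLT hF
    have hhom := homogeneousComponent_isHomogeneous (e + 1) F
    refine hhom.eq_zero_of_pderiv_eq_zero (eq_zero_of_sum_smul_eq_zero hδ fun g => ?_)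
    rw [← symbolDer_apply]
    obtain ⟨G, hG, h⟩ := exists_comm_quant δ g hF
    rw [h0, comm_zero_left] at h
    have h1 := ih (e + 1) (by omega) _
      (add_mem (symbolDer_mem_degLT δ g hF) (degLT_mono (by omega) hG)) h.symm
    have h2 : symbolDer δ g (homogeneousComponent (e + 1) F) =
        -(symbolDer δ g (F - homogeneousComponent (e + 1) F) + G) := by
      rw [map_sub, eq_neg_iff_add_eq_zero, ← h1]
      abel
    -- This polynomial is also homogeneous of degree `e`, so it must vanish.
    have h3 : symbolDer δ g (homogeneousComponent (e + 1) F) ∈ degLT A n e := by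
      rw [h2]
      exact neg_mem (add_mem (symbolDer_mem_degLT δ g (sub_homogeneousComponent_mem_degLT hF)) hG)
    rw [← homogeneousComponent_eq_of_isHomogeneous (hhom.symbolDer δ g),
      homogeneousComponent_of_mem_degLT h3]

theorem quant_injective {δ : Fin n → derLog f} (hδ : LinearIndependent A δ) :
    Function.Injective (quant δ) := by
  rw [injective_iff_map_eq_zero]
  intro F hF
  obtain ⟨d, hd⟩ := exists_mem_degLT F
  exact eq_zero_of_quant_eq_zero hδ d F hd hF

theorem quant_mem_stableOps (δ : Fin n → derLog f) (F : MvPolynomial (Fin n) A) :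
    quant δ F ∈ stableOps f := by
  rw [F.as_sum, map_sum]
  refine sum_mem fun i _ => ?_
  rw [quant_monomial]
  refine mul_mem (lmul_mem_stableOps f (coeff i F)) (list_prod_mem ?_)
  intro P hP
  obtain ⟨k, rfl⟩ := (List.mem_ofFn' _ _).1 hP
  exact pow_mem (toOp_mem_stableOps _) _

/-- A polynomial-valued derivation `T` with `T(f) ∈ (f)` is a combination of a basis of
`Der(log f)`. -/
theorem exists_eq_sum_smul (δ : Module.Basis (Fin n) A (derLog f))
    (T : A →ₗ[ℂ] MvPolynomial (Fin n) A) (hT : ∀ g h, T (g * h) = g • T h + h • T g)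
    {G : MvPolynomial (Fin n) A} (hf : T f = f • G) {e : ℕ} (he : ∀ g, (T g).IsHomogeneous e) :
    ∃ R : Fin n → MvPolynomial (Fin n) A, (∀ k, (R k).IsHomogeneous e) ∧
      ∀ g, T g = ∑ k, (δ k : Derivation ℂ A A) g • R k := by
  let η : (Fin n →₀ ℕ) → derLog f := fun i =>
    ⟨Derivation.mk' (((lcoeff A i).restrictScalars ℂ).comp T) (fun g h => by
      simp [hT]), by
      refine Ideal.mem_span_singleton.2 ⟨coeff i G, ?_⟩
      simp [hf]⟩
  have hη : ∀ i g, (η i : Derivation ℂ A A) g = coeff i (T g) := fun i g => rfl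
  have hη0 : ∀ i : Fin n →₀ ℕ, i.degree ≠ e → η i = 0 := fun i hi =>
    Subtype.ext (Derivation.ext fun g => (he g).coeff_eq_zero hi)
  -- Homogeneity confines the nonzero coefficients of all `T g` to the finitely many exponents of
  -- degree `e`, so the `R k` are polynomials independent of `g`.
  let I : Finset (Fin n →₀ ℕ) := Finset.univ.finsuppAntidiag e
  have hI : ∀ i : Fin n →₀ ℕ, i ∉ I → η i = 0 := fun i hi => hη0 i fun h => hi (by
    simpa [I, Finset.mem_finsuppAntidiag, Finsupp.degree_eq_sum] using h)
  refine ⟨fun k => ∑ i ∈ I, monomial i (δ.repr (η i) k), fun k => ?_, fun g => ?_⟩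
  · refine IsHomogeneous.sum _ _ _ fun i hi => isHomogeneous_monomial _ ?_
    simpa [I, Finset.mem_finsuppAntidiag, Finsupp.degree_eq_sum] using hi
  · ext i
    have h1 : ∀ k, coeff i (∑ j ∈ I, monomial j (δ.repr (η j) k)) = δ.repr (η i) k := fun k => by
      simp only [coeff_sum, coeff_monomial, Finset.sum_ite_eq']
      split_ifs with h
      · rfl
      · rw [hI i h, map_zero]; rfl
    simp only [coeff_sum, coeff_smul, smul_eq_mul] at h1 ⊢
    simp only [h1]
    rw [← hη, ← δ.sum_repr (η i), sum_smul_derLog_apply]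
    simp [mul_comm]

/-- Symmetry of the mixed derivatives: the integrability condition for a symbol. -/
theorem exists_pderiv_eq (R : Fin n → MvPolynomial (Fin n) A) {e : ℕ}
    (hR : ∀ k, (R k).IsHomogeneous e) (h : ∀ k l, pderiv l (R k) = pderiv k (R l)) :
    ∃ F : MvPolynomial (Fin n) A, F.IsHomogeneous (e + 1) ∧ ∀ k, pderiv k F = R k := by
  -- The Poincaré lemma for homogeneous forms: by symmetry and Euler's identity, `∂_l ∑ X_k R_k =
  -- R_l + e R_l`.
  refine ⟨C (algebraMap ℂ A ((e + 1 : ℕ) : ℂ)⁻¹) * ∑ k, X k * R k, ?_, fun l => ?_⟩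
  · refine IsHomogeneous.C_mul (IsHomogeneous.sum _ _ _ fun k _ => ?_) _
    rw [add_comm]
    exact (isHomogeneous_X _ _).mul (hR k)
  · have h1 : pderiv l (∑ k, X k * R k) = (e + 1 : ℕ) • R l := by
      rw [map_sum, add_smul, ← (hR l).sum_X_mul_pderiv, one_smul]
      simp only [Derivation.leibniz, pderiv_X, smul_eq_mul, h _ l, Finset.sum_add_distrib,
        Pi.single_apply, mul_ite, mul_one, mul_zero, Finset.sum_ite_eq', Finset.mem_univ, if_true]
    rw [pderiv_C_mul, h1, ← Nat.cast_smul_eq_nsmul ℂ, ← smul_eq_C_mul, algebraMap_smul,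
      inv_smul_smul₀ (Nat.cast_ne_zero.2 e.succ_ne_zero)]

/-- Given that the commutators `[P, g]` are polynomials of degree at most `e` in the `δ_k`, there is
a homogeneous polynomial `F` of degree `e + 1` such that `P - quant F` has order at most `e`. -/
theorem exists_symbol [NoZeroDivisors A] (δ : Module.Basis (Fin n) A (derLog f)) {e : ℕ}
    (ih : ∀ Q ∈ stableOps f, Q ∈ ordLT A (e + 1) → ∃ F ∈ degLT A n (e + 1), Q = quant δ F)
    {P : Module.End ℂ A} (hP : P ∈ stableOps f) (hd : P ∈ ordLT A (e + 2)) :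
    ∃ F ∈ degLT A n (e + 2), P - quant δ F ∈ ordLT A (e + 1) := by
  have hδ := δ.linearIndependent
  have inj := quant_injective hδ
  choose K hK hPK using fun g => ih _ (comm_mem_stableOps hP g) (hd g)
  -- The principal symbol of `[P, g]`; injectivity of `quant` makes the chosen `K g` unique, hence
  -- linear in `g`.
  let T : A →ₗ[ℂ] MvPolynomial (Fin n) A :=
    { toFun := fun g => homogeneousComponent e (K g)
      map_add' := fun g h => by
        rw [← map_add]
        congr 1
        apply inj
        rw [map_add, ← hPK, ← hPK, ← hPK, comm_add_right]
      map_smul' := fun c g => by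
        rw [RingHom.id_apply, ← algebraMap_smul A c (homogeneousComponent e (K g)), ← map_smul]
        congr 1
        apply inj
        rw [map_smul, ← hPK, ← hPK, comm_smul_right]
        exact (algebraMap_smul A c _).symm }
  have hT : ∀ g h, T (g * h) = g • T h + h • T g := fun g h => by
    obtain ⟨G, hG, hc⟩ := exists_comm_quant δ h (hK g)
    have h1 : K (g * h) = g • K h + h • K g + (symbolDer δ h (K g) + G) := by
      apply inj
      rw [map_add, map_add, map_smul, map_smul, ← hc, ← hPK, ← hPK, ← hPK, comm_mul_right]
      abel
    show homogeneousComponent e (K (g * h)) = _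
    rw [h1, map_add, homogeneousComponent_of_mem_degLT (add_mem (symbolDer_mem_degLT δ h (hK g))
      (degLT_mono (by omega) hG)), add_zero, map_add, map_smul, map_smul]
    rfl
  obtain ⟨Q, hQ, hQd, hQf⟩ := exists_smul_eq_comm hP hd
  obtain ⟨H, hH, rfl⟩ := ih Q hQ hQd
  have hTf : T f = f • homogeneousComponent e H := by
    rw [← map_smul]
    show homogeneousComponent e (K f) = _
    congr 1
    apply inj
    rw [← hPK, hQf, map_smul]
  obtain ⟨R, hR, hTR⟩ := exists_eq_sum_smul δ T hT hTf
    fun g => homogeneousComponent_isHomogeneous e (K g)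
  have hKT : ∀ g, K g - T g ∈ degLT A n e := fun g => sub_homogeneousComponent_mem_degLT (hK g)
  -- For `e = 0` the `R k` are constants. Otherwise the symbols of `[[P, g], h] = [[P, h], g]` are
  -- compared, and independence of the `δ_k` is used twice, to remove first `g` and then `h`.
  have hsymm : ∀ k l, pderiv l (R k) = pderiv k (R l) := by
    cases e with
    | zero =>
      intro k l
      have : ∀ k, ∃ a, R k = C a := fun k => ⟨_, (totalDegree_eq_zero_iff_eq_C).1
        ((totalDegree_zero_iff_isHomogeneous _).2 (hR k))⟩
      obtain ⟨a, ha⟩ := this k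
      obtain ⟨b, hb⟩ := this l
      rw [ha, hb, pderiv_C, pderiv_C]
    | succ e =>
      have hTsymm : ∀ g h, symbolDer δ h (T g) = symbolDer δ g (T h) := fun g h => by
        have hmem : ∀ g h, ∃ L, L - symbolDer δ h (T g) ∈ degLT A n e ∧
            quant δ L = comm (comm P g) h := fun g h => by
          obtain ⟨G, hG, hc⟩ := exists_comm_quant δ h (hK g)
          refine ⟨_, ?_, by rw [hPK g, hc]⟩
          rw [add_sub_right_comm, ← map_sub]
          exact add_mem (symbolDer_mem_degLT δ h (hKT g)) hG
        obtain ⟨L, hL, hL'⟩ := hmem g h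
        obtain ⟨L', hM, hM'⟩ := hmem h g
        have hLL : L = L' := inj (by rw [hL', hM', comm_comm])
        have hdiff : symbolDer δ h (T g) - symbolDer δ g (T h) ∈ degLT A n e := by
          have := sub_mem hM hL
          rwa [hLL, sub_sub_sub_cancel_left] at this
        have hhom : ∀ g h, (symbolDer δ h (T g)).IsHomogeneous e := fun g h =>
          (homogeneousComponent_isHomogeneous (e + 1) (K g)).symbolDer δ h
        have := homogeneousComponent_of_mem_degLT hdiff
        rw [map_sub, homogeneousComponent_eq_of_isHomogeneous (hhom g h),
          homogeneousComponent_eq_of_isHomogeneous (hhom h g)] at this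
        exact sub_eq_zero.1 this
      have h1 : ∀ h k, symbolDer δ h (R k) -
          ∑ l, (δ l : Derivation ℂ A A) h • pderiv k (R l) = 0 := fun h =>
        eq_zero_of_sum_smul_eq_zero hδ fun g => by
          have := hTsymm g h
          rw [symbolDer_apply _ g, hTR g, map_sum] at this
          simp only [smul_sub, Finset.sum_sub_distrib]
          rw [sub_eq_zero]
          simp only [Derivation.map_smul] at this
          rw [this]
          refine Finset.sum_congr rfl fun k _ => ?_
          rw [hTR h, map_sum]
          simp only [Derivation.map_smul]
      intro k l
      refine sub_eq_zero.1 (eq_zero_of_sum_smul_eq_zero hδ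
        (R := fun l => pderiv l (R k) - pderiv k (R l)) (fun h => ?_) l)
      simp only [smul_sub, Finset.sum_sub_distrib]
      rw [← symbolDer_apply]
      exact h1 h k
  obtain ⟨F, hF, hFR⟩ := exists_pderiv_eq R hR hsymm
  have hFd : F ∈ degLT A n (e + 2) := hF.mem_degLT (by omega)
  refine ⟨F, hFd, fun g => ?_⟩
  obtain ⟨G, hG, hc⟩ := exists_comm_quant δ g hFd
  have hFT : symbolDer δ g F = T g := by
    rw [symbolDer_apply, hTR]
    simp only [hFR]
  rw [comm_sub_left, hPK, hc, ← map_sub, hFT, ← sub_sub]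
  exact quant_mem_ordLT δ (sub_mem (hKT g) hG)

/-- Subtracting the operator with the same symbol lowers the order and preserves stability, since
`quant F` is stable; order zero is multiplication by `P 1`. -/
theorem exists_eq_quant [NoZeroDivisors A] (δ : Module.Basis (Fin n) A (derLog f)) (d : ℕ) :
    ∀ P ∈ stableOps f, P ∈ ordLT A d → ∃ F ∈ degLT A n d, P = quant δ F := by
  induction d with
  | zero =>
    intro P _ hP
    exact ⟨0, zero_mem _, by rw [map_zero, mem_ordLT_zero.1 hP]⟩
  | succ d ih =>
    intro P hP hd
    cases d with
    | zero =>
      refine ⟨C (P 1), IsHomogeneous.mem_degLT (isHomogeneous_C _ _) Nat.zero_lt_one, ?_⟩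
      rw [quant_C]
      exact eq_lmul_of_comm_eq_zero hd
    | succ e =>
      obtain ⟨F, hF, hPF⟩ := exists_symbol δ ih hP hd
      obtain ⟨G, hG, h⟩ := ih _ (sub_mem hP (quant_mem_stableOps δ F)) hPF
      refine ⟨F + G, add_mem hF (degLT_mono (by omega) hG), ?_⟩
      rw [map_add, ← h, add_sub_cancel]

/-! ### Unique expansions and generators of the ring of logarithmic operators -/

variable (A n) in
/-- Families of coefficients as polynomials. -/
def coeffEquiv : ((Fin n → ℕ) →₀ A) ≃ₗ[A] MvPolynomial (Fin n) A :=
  Finsupp.domLCongr Finsupp.equivFunOnFinite.symm ≪≫ₗ (basisMonomials (Fin n) A).repr.symm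

theorem polyOp_eq_quant (δ : Fin n → derLog f) (β : (Fin n → ℕ) →₀ A) :
    polyOp δ β = quant δ (coeffEquiv A n β) := by
  rw [polyOp]
  conv_rhs => rw [← Finsupp.sum_single β]
  rw [map_finsuppSum, map_finsuppSum]
  refine Finsupp.sum_congr fun i _ => ?_
  simp only [coeffEquiv, LinearEquiv.trans_apply, Finsupp.domLCongr_single,
    Module.Basis.repr_symm_single, coe_basisMonomials, smul_monomial, smul_eq_mul, mul_one,
    quant_monomial]
  rfl

theorem logOps_le_range_quant [NoZeroDivisors A] (δ : Module.Basis (Fin n) A (derLog f))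
    {P : Module.End ℂ A} (hP : P ∈ logOps f) : ∃ F, P = quant δ F := by
  obtain ⟨hD, hS⟩ := mem_logOps.1 hP
  obtain ⟨d, hd⟩ := exists_mem_ordLT_of_mem_diffOps hD
  obtain ⟨F, -, hF⟩ := exists_eq_quant δ d P hS hd
  exact ⟨F, hF⟩

theorem quant_mem_adjoin (δ : Fin n → derLog f) (F : MvPolynomial (Fin n) A) :
    quant δ F ∈ Algebra.adjoin ℂ (mulOps A ∪ Set.range fun k => toOp (δ k)) := by
  rw [F.as_sum, map_sum]
  refine sum_mem fun i _ => ?_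
  rw [quant_monomial]
  have h : Algebra.lmul ℂ A (coeff i F) ∈
      Algebra.adjoin ℂ (mulOps A ∪ Set.range fun k => toOp (δ k)) :=
    Algebra.subset_adjoin (Or.inl (Set.mem_range_self _))
  have hprod : monomialOp δ i ∈
      Algebra.adjoin ℂ (mulOps A ∪ Set.range fun k => toOp (δ k)) := by
    refine list_prod_mem fun P hP => ?_
    obtain ⟨k, rfl⟩ := (List.mem_ofFn' _ _).1 hP
    refine pow_mem ?_ _
    exact Algebra.subset_adjoin (Or.inr ⟨k, rfl⟩)
  exact mul_mem h hprod

theorem adjoin_derLog_le_logOps (f : A) :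
    Algebra.adjoin ℂ (mulOps A ∪ Set.range fun η : derLog f => toOp η) ≤ logOps f := by
  refine Algebra.adjoin_le ?_
  rintro P (⟨a, rfl⟩ | ⟨η, rfl⟩)
  · exact mem_logOps.2 ⟨Algebra.subset_adjoin (Or.inl ⟨a, rfl⟩), lmul_mem_stableOps f a⟩
  · exact mem_logOps.2 ⟨Algebra.subset_adjoin (Or.inr ⟨η, rfl⟩), toOp_mem_stableOps η⟩

theorem adjoin_range_le_adjoin_derLog (δ : Fin n → derLog f) :
    Algebra.adjoin ℂ (mulOps A ∪ Set.range fun k => toOp (δ k)) ≤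
      Algebra.adjoin ℂ (mulOps A ∪ Set.range fun η : derLog f => toOp η) := by
  refine Algebra.adjoin_mono (Set.union_subset_union_right _ ?_)
  rintro _ ⟨k, rfl⟩
  exact ⟨δ k, rfl⟩

theorem existsUnique_eq_polyOp [NoZeroDivisors A] (δ : Module.Basis (Fin n) A (derLog f))
    {P : Module.End ℂ A} (hP : P ∈ logOps f) :
    ∃! β : (Fin n → ℕ) →₀ A, P = polyOp δ β := by
  obtain ⟨F, rfl⟩ := logOps_le_range_quant δ hP
  refine ⟨(coeffEquiv A n).symm F, ?_, fun β hβ => ?_⟩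
  · simp [polyOp_eq_quant]
  · simp only [polyOp_eq_quant] at hβ
    rw [quant_injective δ.linearIndependent hβ, LinearEquiv.symm_apply_apply]

theorem logOps_le_adjoin_range [NoZeroDivisors A] (δ : Module.Basis (Fin n) A (derLog f)) :
    logOps f ≤ Algebra.adjoin ℂ (mulOps A ∪ Set.range fun k => toOp (δ k)) := fun P hP => by
  obtain ⟨F, rfl⟩ := logOps_le_range_quant δ hP
  exact quant_mem_adjoin δ F

end FreeDivisor

end LogOp

end

theorem theorem2p1p4 (n : ℕ) {X : Type*} [TopologicalSpace X]
    [ChartedSpace (EuclideanSpace ℂ (Fin n)) X]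
    [IsManifold 𝓘(ℂ, EuclideanSpace ℂ (Fin n)) ω X] (x : X)
    (f : LogOp.holGerm n x) (hf : LogOp.IsFree f)
    (δ : Module.Basis (Fin n) (LogOp.holGerm n x) (LogOp.derLog f)) :
    (∀ P ∈ LogOp.logOps f,
      ∃! β : (Fin n → ℕ) →₀ LogOp.holGerm n x, P = LogOp.polyOp δ β) ∧
    LogOp.logOps f =
      Algebra.adjoin ℂ (LogOp.mulOps (LogOp.holGerm n x) ∪ Set.range fun k => LogOp.toOp (δ k)) ∧
    LogOp.logOps f =
      Algebra.adjoin ℂ (LogOp.mulOps (LogOp.holGerm n x) ∪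
        Set.range fun η : LogOp.derLog f => LogOp.toOp η) :=
  ⟨fun _ hP => LogOp.existsUnique_eq_polyOp δ hP,
    le_antisymm (LogOp.logOps_le_adjoin_range δ)
      ((LogOp.adjoin_range_le_adjoin_derLog δ).trans (LogOp.adjoin_derLog_le_logOps f)),
    le_antisymm ((LogOp.logOps_le_adjoin_range δ).trans (LogOp.adjoin_range_le_adjoin_derLog δ))
      (LogOp.adjoin_derLog_le_logOps f)⟩
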